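/- Let $G=\mathrm{PSL}_2(\mathbb R)$, acting on the upper half plane $\mathbb H$ by Möbius transformations. A modular embedding $(p,\rho)$ consists of a group homomorphism $\rho:\Gamma\to G$ from a lattice $\Gamma=\mathrm{dom}(\rho)\le G$ and a $\rho$-equivariant holomorphic map $p:\mathbb H\to\mathbb H$, i.e. $p(\gamma z)=\rho(\gamma)p(z)$ for all $\gamma\in\Gamma$, $z\in\mathbb H$. For $g\in G$ let $c_g(x)=gxg^{-1}$; for $(g,h)\in G\times G$ put $g(p,\rho)h^{-1}:=(g\circ p\circ h^{-1},\,c_g\circ\rho\circ c_{h^{-1}})$, a modular embedding with lattice $h\Gamma h^{-1}$. Two modular embeddings $(p_1,\rho_1)$, $(p_2,\rho_2)$ are commensurable if there is a subgroup $\Gamma'\le G$ which has finite index in both $\mathrm{dom}(\rho_1)$ and $\mathrm{dom}(\rho_2)$ such that $\rho_1=\rho_2$ on $\Gamma'$. The commensurator of $(p,\rho)$ is the group $$\mathrm{Comm}(p,\rho)=\{(g,h)\in G\times G : (p,\rho)\text{ and } g(p,\rho)h^{-1}\text{ are commensurable}\}.$$ Let $\mathrm{Comm}_G(p,\rho)\le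 G$ be its image under $(g,h)\mapsto h$ (when $p$ is non-constant this projection is injective on $\mathrm{Comm}(p,\rho)$, and $\mathrm{Comm}_G(p,\rho)$ is $\mathrm{Comm}(p,\rho)$ regarded as a subgroup of $G$). Then, for every modular embedding $(p,\rho)$, $\Gamma\subset\mathrm{Comm}_G(p,\rho)$, and exactly one of the following holds: $\mathrm{Comm}_G(p,\rho)$ is dense in $G$, or $\Gamma$ is a subgroup of finite index in $\mathrm{Comm}_G(p,\rho)$. -/

import Mathlib

open MeasureTheory UpperHalfPlane
open scoped Manifold MatrixGroups Pointwise

/-- The group `G = PSL₂(ℝ)`, with the quotient topology coming from `SL₂(ℝ)`. -/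
abbrev PSL2R : Type := PSL(2, ℝ)

noncomputable section

/-- `PSL₂(ℝ)` carries its Borel `σ`-algebra. -/
instance PSL2R.instMeasurableSpace : MeasurableSpace PSL2R := borel PSL2R

instance PSL2R.instBorelSpace : BorelSpace PSL2R := ⟨rfl⟩

/-- The action of `PSL₂(ℝ)` on the upper half plane by Möbius transformations. -/
instance PSL2R.instMulAction : MulAction PSL2R ℍ :=
  MulAction.compHom ℍ (Matrix.ProjectiveSpecialLinearGroup.toPGL (n := Fin 2) (R := ℝ))

/-- The class of a matrix acts as the matrix does. -/
theorem PSL2R.mk_smul (g : SL(2, ℝ)) (z : ℍ) : ((g : PSL2R) • z : ℍ) = g • z := rfl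

theorem PSL2R.mdifferentiable_smul (g : PSL2R) :
    MDifferentiable 𝓘(ℂ) 𝓘(ℂ) (fun z : ℍ => g • z) := by
  induction g using QuotientGroup.induction_on with
  | H g =>
    exact UpperHalfPlane.mdifferentiable_smul
      (g := (Matrix.SpecialLinearGroup.toGL g : GL (Fin 2) ℝ)) (by simp)

/-- A subgroup `Γ` of a topological group `G` is a lattice if it is discrete and has finite
covolume: the action of `Γ` on `G` by right multiplication has a fundamental domain of finite
Haar measure. -/
structure IsLattice {G : Type*} [Group G] [TopologicalSpace G] [MeasurableSpace G]
    (Γ : Subgroup G) : Prop where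
  discrete : DiscreteTopology Γ
  finite_covolume : ∃ (μ : Measure G) (F : Set G),
    μ.IsHaarMeasure ∧ IsFundamentalDomain Γ.op F μ ∧ μ F < ⊤

/-- The conjugate `h Γ h⁻¹`. -/
def conjSubgroup {G : Type*} [Group G] (h : G) (Γ : Subgroup G) : Subgroup G :=
  Γ.map (MulAut.conj h).toMonoidHom

theorem mem_conjSubgroup {G : Type*} [Group G] {h : G} {Γ : Subgroup G} {x : G} :
    x ∈ conjSubgroup h Γ ↔ h⁻¹ * x * h ∈ Γ := by
  simp only [conjSubgroup, Subgroup.mem_map, MulEquiv.coe_toMonoidHom, MulAut.conj_apply]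
  constructor
  · rintro ⟨y, hy, rfl⟩
    simpa [mul_assoc] using hy
  · intro hx
    exact ⟨_, hx, by group⟩

theorem conjSubgroup_mono {G : Type*} [Group G] (h : G) {Γ Δ : Subgroup G} (H : Γ ≤ Δ) :
    conjSubgroup h Γ ≤ conjSubgroup h Δ := Subgroup.map_mono H

theorem relIndex_conjSubgroup {G : Type*} [Group G] (h : G) (Γ Δ : Subgroup G) :
    (conjSubgroup h Γ).relIndex (conjSubgroup h Δ) = Γ.relIndex Δ :=
  Subgroup.relIndex_map_map_of_injective Γ Δ (MulAut.conj h).injective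

theorem IsLattice.conj {G : Type*} [Group G] [TopologicalSpace G] [IsTopologicalGroup G]
    [MeasurableSpace G] [BorelSpace G] {Γ : Subgroup G} (hΓ : IsLattice Γ) (h : G) :
    IsLattice (conjSubgroup h Γ) := by
  have hc : Continuous (MulAut.conj h : G ≃* G) := by
    change Continuous fun x => h * x * h⁻¹
    fun_prop
  have hc' : Continuous (MulAut.conj h : G ≃* G).symm := by
    change Continuous fun x => h⁻¹ * x * h
    fun_prop
  let φ : G ≃ₜ G := ⟨(MulAut.conj h).toEquiv, hc, hc'⟩
  obtain ⟨hd, μ, F, hμ, hF, hfin⟩ := hΓ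
  refine ⟨?_, μ.map (MulAut.conj h), φ '' F, ?_, ?_, ?_⟩
  · have hemb : Topology.IsEmbedding
        (fun x : conjSubgroup h Γ => (⟨h⁻¹ * x * h, mem_conjSubgroup.1 x.2⟩ : Γ)) := by
      refine Topology.IsEmbedding.of_comp (g := ((↑) : Γ → G)) ?_ continuous_subtype_val ?_
      · exact Continuous.subtype_mk (hc'.comp continuous_subtype_val) _
      · exact φ.symm.isEmbedding.comp Topology.IsEmbedding.subtypeVal
    exact hemb.discreteTopology
  · exact (MulAut.conj h).isHaarMeasure_map μ hc hc'
  · have hq : Measure.QuasiMeasurePreserving φ.toEquiv.symm (μ.map (MulAut.conj h)) μ := by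
      refine ⟨hc'.measurable, ?_⟩
      have e1 : (μ.map (MulAut.conj h)).map φ.toEquiv.symm = μ := by
        refine (Measure.map_map (g := (φ.toEquiv.symm : G → G)) hc'.measurable
          hc.measurable).trans ?_
        have : ((φ.toEquiv.symm : G → G) ∘ (MulAut.conj h : G ≃* G)) = id := by
          funext x
          exact (MulAut.conj h).symm_apply_apply x
        rw [this, Measure.map_id]
      exact e1.absolutelyContinuous
    let e : (conjSubgroup h Γ).op ≃ Γ.op :=
      { toFun := fun x => ⟨MulOpposite.op (h⁻¹ * x.1.unop * h), mem_conjSubgroup.1 x.2⟩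
        invFun := fun x => ⟨MulOpposite.op (h * x.1.unop * h⁻¹), by
          change h * x.1.unop * h⁻¹ ∈ conjSubgroup h Γ
          rw [mem_conjSubgroup]
          have hx : x.1.unop ∈ Γ := x.2
          simpa only [mul_assoc, inv_mul_cancel_left, inv_mul_cancel, mul_one] using hx⟩
        left_inv := fun x => by
          ext
          simp [mul_assoc]
        right_inv := fun x => by
          ext
          simp [mul_assoc] }
    refine hF.image_of_equiv φ.toEquiv hq e ?_
    intro γ x
    change h * (x * (h⁻¹ * γ.1.unop * h)) * h⁻¹ = (h * x * h⁻¹) * γ.1.unop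
    group
  · have : μ.map (MulAut.conj h) = μ.map φ.toMeasurableEquiv := rfl
    rw [this, MeasurableEquiv.map_apply]
    have h2 : φ.toMeasurableEquiv ⁻¹' (φ '' F) = F := φ.injective.preimage_image F
    rw [h2]
    exact hfin

/-- A modular embedding (of rank 2 and weight 1): a lattice `Γ` in `PSL₂(ℝ)`, a homomorphism
`ρ : Γ → PSL₂(ℝ)`, and a `ρ`-equivariant holomorphic map `p : ℍ → ℍ`. -/
structure ModularEmbedding where
  /-- the lattice `Γ` on which `ρ` is defined -/
  dom : Subgroup PSL2R
  isLattice : IsLattice dom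
  /-- the representation -/
  ρ : dom →* PSL2R
  /-- the equivariant map -/
  p : ℍ → ℍ
  holomorphic : MDifferentiable 𝓘(ℂ) 𝓘(ℂ) p
  equivariant : ∀ (γ : dom) (z : ℍ), p ((γ : PSL2R) • z) = ρ γ • p z

namespace ModularEmbedding

/-- The modular embedding `g (p, ρ) h⁻¹ = (g ∘ p ∘ h⁻¹, c_g ∘ ρ ∘ c_{h⁻¹})`, where `c_g` is
conjugation by `g`; its lattice is `h Γ h⁻¹`. -/
def act (g h : PSL2R) (P : ModularEmbedding) : ModularEmbedding where
  dom := conjSubgroup h P.dom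
  isLattice := P.isLattice.conj h
  ρ :=
    { toFun := fun x => g * P.ρ ⟨h⁻¹ * x * h, mem_conjSubgroup.1 x.2⟩ * g⁻¹
      map_one' := by
        have : (⟨h⁻¹ * ((1 : conjSubgroup h P.dom) : PSL2R) * h, mem_conjSubgroup.1 (one_mem _)⟩ :
            P.dom) = 1 := by
          ext1
          simp
        rw [this, map_one]
        simp
      map_mul' := fun x y => by
        have : (⟨h⁻¹ * ((x * y : conjSubgroup h P.dom) : PSL2R) * h,
            mem_conjSubgroup.1 (x * y).2⟩ : P.dom) =
            ⟨h⁻¹ * x * h, mem_conjSubgroup.1 x.2⟩ * ⟨h⁻¹ * y * h, mem_conjSubgroup.1 y.2⟩ := by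
          ext1
          simp [mul_assoc]
        rw [this, map_mul]
        group }
  p := fun z => g • P.p (h⁻¹ • z)
  holomorphic := (PSL2R.mdifferentiable_smul g).comp
    (P.holomorphic.comp (PSL2R.mdifferentiable_smul h⁻¹))
  equivariant := fun γ z => by
    have h1 := P.equivariant ⟨h⁻¹ * γ * h, mem_conjSubgroup.1 γ.2⟩ (h⁻¹ • z)
    have h2 : (h⁻¹ * (γ : PSL2R) * h) • (h⁻¹ • z) = h⁻¹ • (γ : PSL2R) • z := by
      simp only [smul_smul]
      congr 1
      group
    simp only [h2] at h1
    rw [h1]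
    simp only [MonoidHom.coe_mk, OneHom.coe_mk, smul_smul]
    congr 1
    group

/-- Two modular embeddings are commensurable if their representations agree on a subgroup that
has finite index in both of their lattices. -/
def Commensurable (P Q : ModularEmbedding) : Prop :=
  ∃ (Γ' : Subgroup PSL2R) (hP : Γ' ≤ P.dom) (hQ : Γ' ≤ Q.dom),
    Γ'.IsFiniteRelIndex P.dom ∧ Γ'.IsFiniteRelIndex Q.dom ∧
      ∀ (x : PSL2R) (hx : x ∈ Γ'), P.ρ ⟨x, hP hx⟩ = Q.ρ ⟨x, hQ hx⟩

theorem Commensurable.symm {P Q : ModularEmbedding} (h : Commensurable P Q) :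
    Commensurable Q P := by
  obtain ⟨Γ', hP, hQ, iP, iQ, e⟩ := h
  exact ⟨Γ', hQ, hP, iQ, iP, fun x hx => (e x hx).symm⟩

theorem Commensurable.trans {P Q R : ModularEmbedding} (h : Commensurable P Q)
    (h' : Commensurable Q R) : Commensurable P R := by
  obtain ⟨Γ₁, hP, hQ, iP, iQ, e⟩ := h
  obtain ⟨Γ₂, hQ', hR, iQ', iR, e'⟩ := h'
  have k1 : (Γ₁ ⊓ Γ₂).relIndex Γ₁ ≠ 0 := by
    rw [Subgroup.inf_relIndex_left]
    exact fun h0 => iQ'.1 (Subgroup.relIndex_eq_zero_of_le_right hQ h0)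
  have k2 : (Γ₁ ⊓ Γ₂).relIndex Γ₂ ≠ 0 := by
    rw [Subgroup.inf_relIndex_right]
    exact fun h0 => iQ.1 (Subgroup.relIndex_eq_zero_of_le_right hQ' h0)
  refine ⟨Γ₁ ⊓ Γ₂, inf_le_left.trans hP, inf_le_right.trans hR, ⟨?_⟩, ⟨?_⟩, ?_⟩
  · rw [← Subgroup.relIndex_mul_relIndex _ _ _ inf_le_left hP]
    exact mul_ne_zero k1 iP.1
  · rw [← Subgroup.relIndex_mul_relIndex _ _ _ inf_le_right hR]
    exact mul_ne_zero k2 iR.1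
  · intro x hx
    exact (e x hx.1).trans (e' x hx.2)

theorem Commensurable.act {P Q : ModularEmbedding} (h : Commensurable P Q) (a b : PSL2R) :
    Commensurable (P.act a b) (Q.act a b) := by
  obtain ⟨Γ', hP, hQ, iP, iQ, e⟩ := h
  refine ⟨conjSubgroup b Γ', conjSubgroup_mono b hP, conjSubgroup_mono b hQ, ⟨?_⟩, ⟨?_⟩, ?_⟩
  · change (conjSubgroup b Γ').relIndex (conjSubgroup b P.dom) ≠ 0
    rw [relIndex_conjSubgroup]
    exact iP.1
  · change (conjSubgroup b Γ').relIndex (conjSubgroup b Q.dom) ≠ 0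
    rw [relIndex_conjSubgroup]
    exact iQ.1
  · intro x hx
    have := e _ (mem_conjSubgroup.1 hx)
    change a * P.ρ _ * a⁻¹ = a * Q.ρ _ * a⁻¹
    rw [this]

/-- Embeddings with the same lattice and the same representation are commensurable. -/
theorem Commensurable.of_eq {P Q : ModularEmbedding} (h : P.dom = Q.dom)
    (e : ∀ x (hP : x ∈ P.dom) (hQ : x ∈ Q.dom), P.ρ ⟨x, hP⟩ = Q.ρ ⟨x, hQ⟩) :
    Commensurable P Q :=
  ⟨P.dom, le_rfl, h.le, ⟨by simp⟩, ⟨by simp [h]⟩, fun x hx => e x hx (h ▸ hx)⟩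

theorem commensurable_act_one (P : ModularEmbedding) : Commensurable P (P.act 1 1) := by
  refine .of_eq ?_ ?_
  · ext x
    change _ ↔ x ∈ conjSubgroup 1 P.dom
    simp [mem_conjSubgroup]
  · intro x hP hQ
    change _ = 1 * P.ρ _ * 1⁻¹
    simp

theorem commensurable_act_mul (P : ModularEmbedding) (a b c d : PSL2R) :
    Commensurable ((P.act c d).act a b) (P.act (a * c) (b * d)) := by
  refine .of_eq ?_ ?_
  · ext x
    change x ∈ conjSubgroup b (conjSubgroup d P.dom) ↔ x ∈ conjSubgroup (b * d) P.dom
    simp [mem_conjSubgroup, mul_assoc]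
  · intro x hP hQ
    change a * (c * P.ρ _ * c⁻¹) * a⁻¹ = (a * c) * P.ρ _ * (a * c)⁻¹
    simp [mul_assoc]

/-- The commensurator
`Comm(p, ρ) = {(g, h) ∈ G × G | (p, ρ) and g (p, ρ) h⁻¹ are commensurable}`, a subgroup of
`G × G`. -/
def comm (P : ModularEmbedding) : Subgroup (PSL2R × PSL2R) where
  carrier := {x | Commensurable P (P.act x.1 x.2)}
  one_mem' := P.commensurable_act_one
  mul_mem' := fun {x y} hx hy =>
    (Commensurable.trans hx (Commensurable.act hy x.1 x.2)).trans
      (P.commensurable_act_mul x.1 x.2 y.1 y.2)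
  inv_mem' := fun {x} hx => by
    have h1 := Commensurable.act hx x.1⁻¹ x.2⁻¹
    have h2 := P.commensurable_act_mul x.1⁻¹ x.2⁻¹ x.1 x.2
    rw [inv_mul_cancel, inv_mul_cancel] at h2
    exact ((h1.trans h2).trans P.commensurable_act_one.symm).symm

/-- The commensurator as a subgroup of `G = PSL₂(ℝ)`: the image of `Comm(p, ρ)` under
`(g, h) ↦ h`. -/
def commG (P : ModularEmbedding) : Subgroup PSL2R :=
  P.comm.map (MonoidHom.snd PSL2R PSL2R)

end ModularEmbedding

end

/-! About the commensurator only one fact matters: it contains the lattice `Γ`, since `(ρ γ, γ)`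
fixes `(p, ρ)` up to commensurability. The dichotomy holds for every overgroup `H` of a lattice in
`PSL₂(ℝ)`.

If `H` is discrete, comparing volumes bounds the number of cosets of `Γ` in `H`. If `H` is not
discrete, its preimage `K` in `SL₂(ℝ)` has a nonzero tangent direction `X` at `1`. Finite covolume
gives Poincaré recurrence: for each `g` there are elements `a⁻¹ u⁻ⁿ b` of `K` with `a`, `b` near
`g`, `n` large and `u` unipotent. Conjugating `X` by these and rescaling by `n⁻²` leaves, in the
limit, a multiple of the nilpotent direction of `g⁻¹ u g`. For generic `g` the multiple is nonzero,
so the closure of `K` contains that one-parameter group; by closedness it contains the upper and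
lower unipotents, which generate `SL₂(ℝ)`.

The alternatives exclude each other because a finite-index overgroup of `Γ` is closed and `PSL₂(ℝ)`
is not discrete. -/

open Topology Filter

/-! ### Consequences of finite covolume: recurrence and finite index -/

section Lattice

variable {G : Type*} [Group G] [TopologicalSpace G] [IsTopologicalGroup G]
  [MeasurableSpace G] [BorelSpace G] {μ : Measure G} [μ.IsHaarMeasure] [μ.IsMulRightInvariant]
  {Γ : Subgroup G} [Countable Γ] {F : Set G}

/-- Topological recurrence of left translations on `G ⧸ Γ`. -/
theorem MeasureTheory.IsFundamentalDomain.exists_pow_mul_mul_mem (hF : IsFundamentalDomain Γ.op F μ)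
    (hfin : μ F < ⊤) {O : Set G} (hO : IsOpen O) (hne : O.Nonempty) (u : G) (N : ℕ) :
    ∃ n ≥ N, ∃ g ∈ O, ∃ γ ∈ Γ, u ^ n * g * γ ∈ O := by
  have : Countable Γ.op := (Subgroup.equivOp Γ).symm.countable_iff.2 inferInstance
  set A : Set G := ⋃ γ : Γ.op, γ • O with hA
  have hAo : IsOpen A := isOpen_iUnion fun γ => hO.smul γ
  have hAinv : ∀ γ : Γ.op, γ • A = A := fun γ => by
    rw [hA, Set.smul_set_iUnion]
    simp only [smul_smul]
    exact (Group.mulLeft_bijective γ).surjective.iUnion_comp (fun δ => δ • O)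
  have hOA : O ⊆ A := fun x hx => Set.mem_iUnion.2 ⟨1, by simpa using hx⟩
  have hpos : μ (A ∩ F) ≠ 0 := fun h0 =>
    ((hO.measure_pos μ hne).trans_le (measure_mono hOA)).ne'
      (hF.measure_zero_of_invariant A hAinv h0)
  -- Left and right translations commute, so `v⁻¹ • F` is again a fundamental domain and measures
  -- the invariant set `A` equally.
  have hshift : ∀ v : G, μ ((v • A) ∩ F) = μ (A ∩ F) := fun v => by
    have h1 := (hF.smul_of_comm v⁻¹).measure_set_eq hF hAo.measurableSet (fun γ => by
      rw [Set.preimage_smul, hAinv])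
    rw [← h1, ← measure_smul μ v (A ∩ v⁻¹ • F), Set.smul_set_inter, smul_inv_smul]
  -- Exponents are multiples of `N + 1`, so that any two distinct ones differ by at least `N`.
  have hsum : (μ.restrict F) Set.univ <
      ∑' k : ℕ, (μ.restrict F) ((u ^ ((N + 1) * k)) • A) := by
    have : ∀ k : ℕ, (μ.restrict F) ((u ^ ((N + 1) * k)) • A) = μ (A ∩ F) := fun k => by
      rw [Measure.restrict_apply (hAo.smul _).measurableSet, hshift]
    simp only [this, ENNReal.tsum_const_eq_top_of_ne_zero hpos]
    simpa using hfin
  obtain ⟨i, j, hij, x, hxi, hxj⟩ := exists_nonempty_inter_of_measure_univ_lt_tsum_measure _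
    (fun k => (hAo.smul _).measurableSet.nullMeasurableSet) hsum
  wlog hlt : i < j generalizing i j
  · exact this j i hij.symm hxj hxi (lt_of_le_of_ne (not_lt.1 hlt) hij.symm)
  obtain ⟨a, ha, rfl⟩ := hxi
  obtain ⟨b, hb, hab⟩ := hxj
  obtain ⟨γ, a, ha', rfl⟩ := Set.mem_iUnion.1 ha
  obtain ⟨δ, b, hb', rfl⟩ := Set.mem_iUnion.1 hb
  refine ⟨(N + 1) * (j - i), ?_, b, hb', δ.1.unop * γ.1.unop⁻¹,
    mul_mem δ.2 (inv_mem γ.2), ?_⟩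
  · exact (Nat.le_succ N).trans (Nat.le_mul_of_pos_right _ (by omega))
  · have h : u ^ ((N + 1) * j) * (b * δ.1.unop) = u ^ ((N + 1) * i) * (a * γ.1.unop) := hab
    have e : u ^ ((N + 1) * j) = u ^ ((N + 1) * i) * u ^ ((N + 1) * (j - i)) := by
      rw [← pow_add, ← mul_add]
      congr 2
      omega
    rw [e, mul_assoc] at h
    have h' := mul_left_cancel h
    have : u ^ ((N + 1) * (j - i)) * b * (δ.1.unop * γ.1.unop⁻¹) = a := by
      rw [← mul_assoc, mul_assoc _ b, h', mul_inv_cancel_right]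
    rwa [this]

/-- A subgroup of finite covolume has finite index in every discrete overgroup. -/
theorem MeasureTheory.IsFundamentalDomain.isFiniteRelIndex (hF : IsFundamentalDomain Γ.op F μ)
    (hfin : μ F < ⊤) {H : Subgroup G} (hH : Γ ≤ H) {U : Set G} (hU : U ∈ 𝓝 (1 : G))
    (hUH : ∀ x ∈ H, x ∈ U → x = 1) : Γ.IsFiniteRelIndex H := by
  have : Countable Γ.op := (Subgroup.equivOp Γ).symm.countable_iff.2 inferInstance
  obtain ⟨V, hVo, hV1, hVU⟩ : ∃ V : Set G, IsOpen V ∧ (1 : G) ∈ V ∧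
      ∀ x ∈ V, ∀ y ∈ V, x⁻¹ * y ∈ U := by
    have : Tendsto (fun p : G × G => p.1⁻¹ * p.2) (𝓝 (1, 1)) (𝓝 1) :=
      (by fun_prop : Continuous fun p : G × G => p.1⁻¹ * p.2).tendsto' _ _ (by simp)
    obtain ⟨V, hVo, hV1, hV⟩ := exists_nhds_square (this hU)
    exact ⟨V, hVo, hV1, fun x hx y hy => hV (Set.mk_mem_prod hx hy)⟩
  -- The translates `V h` are disjoint because `V⁻¹ V ⊆ U` meets `H` only in `1`.
  set W : H → Set G := fun h => (MulOpposite.op (h : G)) • V with hW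
  have hWo : ∀ h, IsOpen (W h) := fun h => hVo.smul _
  have hdisj : Pairwise (Function.onFun Disjoint W) := by
    intro h k hk
    refine Set.disjoint_left.2 ?_
    rintro _ ⟨x, hx, rfl⟩ ⟨y, hy, hxy⟩
    apply hk
    have hxy : y * k = x * h := hxy
    have e : x⁻¹ * y = h * (k : G)⁻¹ := by
      rw [inv_mul_eq_iff_eq_mul, ← mul_assoc, ← hxy, mul_inv_cancel_right]
    have := hUH _ (mul_mem h.2 (inv_mem k.2)) (e ▸ hVU x hx y hy)
    exact Subtype.ext (mul_inv_eq_one.1 this)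
  have hle : ∑' h : H, μ (W h ∩ F) ≤ μ F := by
    have := tsum_meas_le_meas_iUnion_of_disjoint (μ.restrict F)
      (fun h => (hWo h).measurableSet) hdisj
    simp only [Measure.restrict_apply (hWo _).measurableSet] at this
    refine this.trans ((measure_mono (Set.subset_univ _)).trans ?_)
    simp
  let Δ := Γ.subgroupOf H
  -- Each coset of `Γ` uses up volume `μ V > 0` inside `F`, so there are only finitely many cosets.
  have hcoset : ∀ q : H ⧸ Δ, ∑' γ : Δ, μ (W (q.out * γ) ∩ F) = μ V := fun q => by
    have e := hF.measure_eq_tsum (W q.out)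
    rw [show μ (W q.out) = μ V from measure_smul μ _ V] at e
    rw [e]
    let φ : Δ ≃ Γ.op := (Subgroup.subgroupOfEquivOfLe hH).toEquiv.trans (Subgroup.equivOp Γ)
    rw [← φ.tsum_eq]
    refine tsum_congr fun γ => ?_
    congr 2
    change _ = (MulOpposite.op ((γ : H) : G)) • (MulOpposite.op ((q.out : H) : G)) • V
    rw [smul_smul, ← MulOpposite.op_mul]
    rfl
  have hfinite : Finite (H ⧸ Δ) := by
    by_contra hinf
    rw [not_finite_iff_infinite] at hinf
    have hinj : Function.Injective fun p : (H ⧸ Δ) × Δ => p.1.out * (p.2 : H) := by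
      rintro ⟨q, γ⟩ ⟨q', γ'⟩ h
      have key : ∀ (q : H ⧸ Δ) (γ : Δ), ((q.out * (γ : H) : H) : H ⧸ Δ) = q := fun q γ => by
        rw [QuotientGroup.mk_mul_of_mem _ γ.2, QuotientGroup.out_eq']
      have hq : q = q' := by
        rw [← key q γ, ← key q' γ']
        exact congrArg _ h
      subst hq
      exact Prod.ext rfl (Subtype.ext (mul_left_cancel h))
    have h1 := ENNReal.tsum_comp_le_tsum_of_injective hinj fun h => μ (W h ∩ F)
    rw [ENNReal.tsum_prod'] at h1
    simp only [hcoset] at h1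
    rw [ENNReal.tsum_const_eq_top_of_ne_zero (hVo.measure_pos μ ⟨1, hV1⟩).ne'] at h1
    exact ((h1.trans hle).trans_lt hfin).ne rfl
  have : Δ.FiniteIndex := Subgroup.finiteIndex_of_finite_quotient
  exact ⟨this.index_ne_zero⟩

end Lattice

/-! ### Finite-index overgroups and unimodularity -/

theorem Subgroup.isClosed_of_isFiniteRelIndex {G : Type*} [Group G] [TopologicalSpace G]
    [IsTopologicalGroup G] {Γ H : Subgroup G} (hH : Γ ≤ H) (hΓ : IsClosed (Γ : Set G))
    (hfin : Γ.IsFiniteRelIndex H) : IsClosed (H : Set G) := by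
  have : (Γ.subgroupOf H).FiniteIndex := ⟨hfin.1⟩
  have e : (H : Set G) = ⋃ q : H ⧸ Γ.subgroupOf H, (q.out : G) • (Γ : Set G) := by
    ext x
    simp only [SetLike.mem_coe, Set.mem_iUnion]
    constructor
    · intro hx
      have := Quotient.out_eq' (QuotientGroup.mk (s := Γ.subgroupOf H) (⟨x, hx⟩ : H))
      replace this := QuotientGroup.eq.1 this
      exact ⟨_, Set.mem_smul_set_iff_inv_smul_mem.2 this⟩
    · rintro ⟨q, y, hy, rfl⟩
      exact mul_mem q.out.2 (hH hy)
  rw [e]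
  exact isClosed_iUnion_of_finite fun q => hΓ.smul _

/-- A finite union of cosets of the closed group `Γ` is closed, so density would force `H = G`. Then
`Γ`, closed of finite index, is open; being discrete, it would make `G` discrete. -/
theorem Subgroup.not_dense_of_isFiniteRelIndex {G : Type*} [Group G] [TopologicalSpace G]
    [IsTopologicalGroup G] [T2Space G] {Γ H : Subgroup G} (hG : ¬ DiscreteTopology G)
    [DiscreteTopology Γ] (hH : Γ ≤ H) (hfin : Γ.IsFiniteRelIndex H) : ¬ Dense (H : Set G) := by
  intro hd
  have hc : IsClosed (Γ : Set G) := Subgroup.isClosed_of_discrete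
  have htop : H = ⊤ := SetLike.coe_injective <| by
    rw [← (Subgroup.isClosed_of_isFiniteRelIndex hH hc hfin).closure_eq, hd.closure_eq,
      Subgroup.coe_top]
  subst htop
  have : Γ.FiniteIndex := ⟨by simpa using hfin.1⟩
  have ho := Subgroup.isOpen_of_isClosed_of_finiteIndex Γ hc
  refine hG (discreteTopology_of_isOpen_singleton_one ?_)
  have := ho.isOpenMap_subtype_val {(1 : Γ)} (isOpen_discrete _)
  simpa using this

/-- The modular character has commutative target, hence is trivial on a perfect group. -/
theorem isMulRightInvariant_of_commutator_eq_top {G : Type*} [Group G] [TopologicalSpace G]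
    [IsTopologicalGroup G] [LocallyCompactSpace G] [SecondCountableTopology G]
    [MeasurableSpace G] [BorelSpace G] (hG : commutator G = ⊤) (μ : Measure G)
    [μ.IsHaarMeasure] : μ.IsMulRightInvariant := by
  refine ⟨fun g => ?_⟩
  have h1 : Measure.modularCharacter g = 1 := by
    have h2 := Abelianization.commutator_subset_ker (Measure.modularCharacter (G := G)).toHomUnits
    rw [hG] at h2
    have h3 := MonoidHom.mem_ker.1 (h2 (Subgroup.mem_top g))
    simpa using congrArg Units.val h3
  have h2 := Measure.isMulLeftInvariant_eq_smul (μ.map (· * g)) μ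
  rw [← Measure.modularCharacterFun_eq_haarScalarFactor] at h2
  rw [h2]
  change (Measure.modularCharacter g) • μ = μ
  rw [h1, one_smul]

/-! ### Topology of `SL₂(ℝ)` and `PSL₂(ℝ)` -/

section Topology

instance Matrix.SpecialLinearGroup.instSecondCountableTopology {n : Type*} [Fintype n]
    [DecidableEq n] : SecondCountableTopology (Matrix.SpecialLinearGroup n ℝ) :=
  haveI : SecondCountableTopology (Matrix n n ℝ) :=
    inferInstanceAs (SecondCountableTopology (n → n → ℝ))
  Matrix.SpecialLinearGroup.isClosedEmbedding_val.isEmbedding.secondCountableTopology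

instance Matrix.SpecialLinearGroup.instLocallyCompactSpace {n : Type*} [Fintype n]
    [DecidableEq n] : LocallyCompactSpace (Matrix.SpecialLinearGroup n ℝ) :=
  haveI : LocallyCompactSpace (Matrix n n ℝ) :=
    inferInstanceAs (LocallyCompactSpace (n → n → ℝ))
  Matrix.SpecialLinearGroup.isClosedEmbedding_val.locallyCompactSpace

instance PSL2R.instSecondCountableTopology : SecondCountableTopology PSL2R :=
  inferInstanceAs (SecondCountableTopology (SL(2, ℝ) ⧸ Subgroup.center SL(2, ℝ)))

instance PSL2R.instLocallyCompactSpace : LocallyCompactSpace PSL2R :=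
  inferInstanceAs (LocallyCompactSpace (SL(2, ℝ) ⧸ Subgroup.center SL(2, ℝ)))

instance PSL2R.instT2Space : T2Space PSL2R := by
  have : IsClosed (Subgroup.center SL(2, ℝ) : Set SL(2, ℝ)) := by
    rw [← Subgroup.centralizer_univ]
    exact Set.isClosed_centralizer _
  exact inferInstanceAs (T2Space (SL(2, ℝ) ⧸ Subgroup.center SL(2, ℝ)))

theorem PSL2R.commutator_eq_top : commutator PSL2R = ⊤ :=
  SL2Simple.PSL_commutator_eq_top ⟨2, by norm_num, by norm_num⟩

end Topology

/-! ### Limits of large powers of elements near the identity -/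

section PowerLimit

variable {A : Type*} [NormedRing A] [NormOneClass A]

/-- The bound keeps `‖B * B‖` instead of `‖B‖ ^ 2`: when `m B → X` with `X² = 0`, the quantity `m²
‖B * B‖` tends to `0`, while `m² ‖B‖²` tends only to `‖X‖²`. -/
theorem norm_one_add_pow_sub_le (B : A) (m : ℕ) :
    ‖(1 + B) ^ m - 1 - m • B‖ ≤ (m : ℝ) ^ 2 * ‖B * B‖ * (1 + ‖B‖) ^ m := by
  induction m with
  | zero => simp
  | succ m ih =>
    have e : (1 + B) ^ (m + 1) - 1 - (m + 1) • B =
        (1 + B) * ((1 + B) ^ m - 1 - m • B) + m • (B * B) := by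
      rw [pow_succ', mul_sub, mul_sub, mul_one, add_mul 1 B (m • B), one_mul, mul_smul_comm,
        add_smul, one_smul]
      abel
    have h1 : ‖(1 + B) * ((1 + B) ^ m - 1 - m • B)‖ ≤
        (1 + ‖B‖) * ((m : ℝ) ^ 2 * ‖B * B‖ * (1 + ‖B‖) ^ m) := by
      refine (norm_mul_le _ _).trans (mul_le_mul ?_ ih (norm_nonneg _) (by positivity))
      exact (norm_add_le _ _).trans (by rw [norm_one])
    have h2 : ‖m • (B * B)‖ ≤ m * ‖B * B‖ := norm_nsmul_le
    have h3 : (m : ℝ) * ‖B * B‖ ≤ m * ‖B * B‖ * (1 + ‖B‖) ^ (m + 1) :=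
      le_mul_of_one_le_right (by positivity) (one_le_pow₀ (by simp))
    rw [e]
    refine (norm_add_le _ _).trans ((add_le_add h1 (h2.trans h3)).trans ?_)
    have h4 : 0 ≤ ((m : ℝ) + 1) * ‖B * B‖ * (1 + ‖B‖) ^ (m + 1) := by positivity
    push_cast
    rw [pow_succ (1 + ‖B‖)] at h4 ⊢
    nlinarith

/-- If `mₙ Bₙ → X` and `X² = 0`, then `(1 + Bₙ) ^ mₙ → 1 + X = exp X`. -/
theorem tendsto_one_add_pow_of_sq_eq_zero [NormedAlgebra ℝ A] {B : ℕ → A} {m : ℕ → ℕ} {X : A}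
    (h : Tendsto (fun n => m n • B n) atTop (𝓝 X)) (hX : X * X = 0) :
    Tendsto (fun n => (1 + B n) ^ m n) atTop (𝓝 (1 + X)) := by
  have h0 : Tendsto (fun n => ‖(m n • B n) * (m n • B n)‖ * Real.exp ‖m n • B n‖) atTop (𝓝 0) := by
    have := (h.mul h).norm.mul (Real.continuous_exp.tendsto _ |>.comp h.norm)
    simpa [hX] using this
  have h1 : Tendsto (fun n => (1 + B n) ^ m n - 1 - m n • B n) atTop (𝓝 0) := by
    refine squeeze_zero_norm (fun n => (norm_one_add_pow_sub_le _ _).trans ?_) h0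
    have hn : ∀ Y : A, ‖m n • Y‖ = m n * ‖Y‖ := fun Y => by
      rw [← Nat.cast_smul_eq_nsmul ℝ, norm_smul, Real.norm_natCast]
    have e1 : ‖(m n • B n) * (m n • B n)‖ = (m n : ℝ) ^ 2 * ‖B n * B n‖ := by
      rw [smul_mul_smul_comm, mul_smul, hn, hn, sq, mul_assoc]
    rw [e1, hn, Real.exp_nat_mul]
    gcongr
    rw [add_comm]
    exact Real.add_one_le_exp _
  have := (h1.add h).add_const 1
  simpa [add_comm] using this

end PowerLimit

/-! ### Tangent directions of a subgroup at the identity -/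

/-- The limits of `t (h - 1)` with `t ≥ 0` and `h → 1` in `K`. -/
def tangentCone (K : Subgroup SL(2, ℝ)) : Set (Matrix (Fin 2) (Fin 2) ℝ) :=
  {X | ((1 : SL(2, ℝ)), X) ∈ closure
    {p : SL(2, ℝ) × Matrix (Fin 2) (Fin 2) ℝ | p.1 ∈ K ∧ ∃ t : ℝ, 0 ≤ t ∧
      p.2 = t • ((p.1 : Matrix (Fin 2) (Fin 2) ℝ) - 1)}}

namespace tangentCone

variable {K : Subgroup SL(2, ℝ)} {X : Matrix (Fin 2) (Fin 2) ℝ}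

theorem isClosed (K : Subgroup SL(2, ℝ)) : IsClosed (tangentCone K) :=
  isClosed_closure.preimage (by fun_prop)

theorem smul_mem (hX : X ∈ tangentCone K) {s : ℝ} (hs : 0 ≤ s) : s • X ∈ tangentCone K := by
  refine map_mem_closure
    (f := fun p : SL(2, ℝ) × Matrix (Fin 2) (Fin 2) ℝ => (p.1, s • p.2)) (by fun_prop) hX ?_
  rintro p ⟨hp, t, ht, e⟩
  exact ⟨hp, s * t, mul_nonneg hs ht, by simp only [e, smul_smul]⟩

theorem conj_mem (hX : X ∈ tangentCone K) {g : SL(2, ℝ)} (hg : g ∈ K) :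
    (g : Matrix (Fin 2) (Fin 2) ℝ) * X * ((g⁻¹ : SL(2, ℝ)) : Matrix (Fin 2) (Fin 2) ℝ) ∈
      tangentCone K := by
  have hgg : (g : Matrix (Fin 2) (Fin 2) ℝ) * ((g⁻¹ : SL(2, ℝ)) : Matrix (Fin 2) (Fin 2) ℝ) = 1 := by
    rw [← Matrix.SpecialLinearGroup.coe_mul, mul_inv_cancel, Matrix.SpecialLinearGroup.coe_one]
  have := map_mem_closure
    (f := fun p : SL(2, ℝ) × Matrix (Fin 2) (Fin 2) ℝ => (g * p.1 * g⁻¹,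
      (g : Matrix (Fin 2) (Fin 2) ℝ) * p.2 * ((g⁻¹ : SL(2, ℝ)) : Matrix (Fin 2) (Fin 2) ℝ)))
    (by fun_prop) hX (t := {p : SL(2, ℝ) × Matrix (Fin 2) (Fin 2) ℝ | p.1 ∈ K ∧ ∃ t : ℝ, 0 ≤ t ∧
      p.2 = t • ((p.1 : Matrix (Fin 2) (Fin 2) ℝ) - 1)}) ?_
  · simpa [tangentCone] using this
  · rintro p ⟨hp, t, ht, e⟩
    refine ⟨mul_mem (mul_mem hg hp) (inv_mem hg), t, ht, ?_⟩
    simp only [e, Matrix.SpecialLinearGroup.coe_mul, mul_smul_comm, smul_mul_assoc, mul_sub,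
      sub_mul, mul_one, hgg]

/-- The equation `det h = 1` reads `tr (h - 1) + det (h - 1) = 0`. Multiplied by `t` it becomes a
closed condition on `(h, t (h - 1))` whose quadratic part vanishes at `h = 1`. -/
theorem trace_eq_zero (hX : X ∈ tangentCone K) : X 0 0 + X 1 1 = 0 := by
  have hc : IsClosed {p : SL(2, ℝ) × Matrix (Fin 2) (Fin 2) ℝ |
      p.2 0 0 + p.2 1 1 + (((p.1 : Matrix (Fin 2) (Fin 2) ℝ) 0 0 - 1) * p.2 1 1 -
        (p.1 : Matrix (Fin 2) (Fin 2) ℝ) 0 1 * p.2 1 0) = 0} := by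
    refine isClosed_eq ?_ continuous_const
    have h1 : Continuous fun p : SL(2, ℝ) × Matrix (Fin 2) (Fin 2) ℝ =>
      (p.1 : Matrix (Fin 2) (Fin 2) ℝ) := by fun_prop
    have h2 := fun i j => h1.matrix_elem i j
    have h3 := fun i j => (continuous_snd (X := SL(2, ℝ))
      (Y := Matrix (Fin 2) (Fin 2) ℝ)).matrix_elem i j
    exact ((h3 0 0).add (h3 1 1)).add ((((h2 0 0).sub continuous_const).mul (h3 1 1)).sub
      ((h2 0 1).mul (h3 1 0)))
  have := closure_minimal (fun p hp => ?_) hc hX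
  · simpa using this
  · obtain ⟨-, t, -, e⟩ := hp
    have hd := Matrix.det_fin_two (p.1 : Matrix (Fin 2) (Fin 2) ℝ)
    rw [p.1.det_coe] at hd
    simp [e]
    linear_combination (-t) * hd

attribute [local instance] Matrix.linftyOpNormedRing Matrix.linftyOpNormedAlgebra

theorem one_add_mem_closure (hX : X ∈ tangentCone K) (hXX : X * X = 0) :
    1 + X ∈ closure ((fun g : SL(2, ℝ) => (g : Matrix (Fin 2) (Fin 2) ℝ)) '' K) := by
  have : FirstCountableTopology (Matrix (Fin 2) (Fin 2) ℝ) :=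
    inferInstanceAs (FirstCountableTopology (Fin 2 → Fin 2 → ℝ))
  obtain ⟨p, hp, hlim⟩ := mem_closure_iff_seq_limit.1 hX
  choose hK t ht e using hp
  have hval : Continuous fun g : SL(2, ℝ) => (g : Matrix (Fin 2) (Fin 2) ℝ) := by fun_prop
  have h1 : Tendsto (fun n => ((p n).1 : Matrix (Fin 2) (Fin 2) ℝ) - 1) atTop (𝓝 0) := by
    have h := ((hval.comp continuous_fst).tendsto _).comp hlim
    have := h.sub_const 1
    simpa using this
  have h2 : Tendsto (fun n => t n • (((p n).1 : Matrix (Fin 2) (Fin 2) ℝ) - 1)) atTop (𝓝 X) := by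
    simpa only [← e, Function.comp_def] using (continuous_snd.tendsto _).comp hlim
  -- Integer exponents keep the powers in `K`; the rounding error is at most `‖h - 1‖ → 0`.
  have h3 : Tendsto (fun n => ⌊t n⌋₊ • (((p n).1 : Matrix (Fin 2) (Fin 2) ℝ) - 1)) atTop (𝓝 X) := by
    have h4 : Tendsto (fun n => ((⌊t n⌋₊ : ℝ) - t n) •
        (((p n).1 : Matrix (Fin 2) (Fin 2) ℝ) - 1)) atTop (𝓝 0) := by
      refine squeeze_zero_norm (fun n => ?_) (by simpa using h1.norm)
      rw [norm_smul]
      refine mul_le_of_le_one_left (norm_nonneg _) ?_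
      rw [Real.norm_eq_abs, abs_le]
      have := Nat.floor_le (ht n)
      have := Nat.lt_floor_add_one (t n)
      constructor <;> linarith
    have := h4.add h2
    simpa [sub_smul, Nat.cast_smul_eq_nsmul] using this
  have h5 := tendsto_one_add_pow_of_sq_eq_zero h3 hXX
  refine mem_closure_of_tendsto h5 (Eventually.of_forall fun n => ?_)
  exact ⟨(p n).1 ^ ⌊t n⌋₊, pow_mem (hK n) _, by simp⟩

/-- Normalise `h - 1` to norm one along `h → 1` and use compactness of the unit sphere. -/
theorem exists_ne_zero (hK : ∀ U ∈ 𝓝 (1 : SL(2, ℝ)), ∃ h ∈ K, h ∈ U ∧ h ≠ 1) :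
    ∃ X ∈ tangentCone K, X ≠ 0 := by
  obtain ⟨U, hU⟩ := (𝓝 (1 : SL(2, ℝ))).exists_antitone_basis
  choose h hhK hhU hh1 using fun n => hK (U n) (hU.mem n)
  have hlim : Tendsto h atTop (𝓝 1) := hU.tendsto hhU
  let Y : ℕ → Matrix (Fin 2) (Fin 2) ℝ := fun n =>
    ‖(h n : Matrix (Fin 2) (Fin 2) ℝ) - 1‖⁻¹ • ((h n : Matrix (Fin 2) (Fin 2) ℝ) - 1)
  have hY : ∀ n, Y n ∈ Metric.sphere (0 : Matrix (Fin 2) (Fin 2) ℝ) 1 := fun n => by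
    have : (h n : Matrix (Fin 2) (Fin 2) ℝ) - 1 ≠ 0 := fun h0 =>
      hh1 n (Subtype.ext (by simpa using sub_eq_zero.1 h0))
    simp [Y, norm_smul, this]
  have : ProperSpace (Matrix (Fin 2) (Fin 2) ℝ) := FiniteDimensional.proper ℝ _
  obtain ⟨X, hX, φ, hφ, hφX⟩ := (isCompact_sphere _ _).tendsto_subseq hY
  refine ⟨X, ?_, fun h0 => by simp [h0] at hX⟩
  exact mem_closure_of_tendsto ((hlim.comp hφ.tendsto_atTop).prodMk_nhds hφX)
    (Eventually.of_forall fun n => ⟨hhK _, _, inv_nonneg.2 (norm_nonneg _), rfl⟩)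

end tangentCone

/-! ### Unipotent subgroups and rescaled conjugation -/

/-- The unipotent one-parameter group of `SL₂(ℝ)` fixing the column vector `(s, -r)`. -/
def unipotent (r s t : ℝ) : SL(2, ℝ) :=
  ⟨!![1 + t * (r * s), t * s ^ 2; -(t * r ^ 2), 1 - t * (r * s)], by
    rw [Matrix.det_fin_two_of]; ring⟩

theorem coe_unipotent (r s t : ℝ) : (unipotent r s t : Matrix (Fin 2) (Fin 2) ℝ) =
    !![1 + t * (r * s), t * s ^ 2; -(t * r ^ 2), 1 - t * (r * s)] := rfl

theorem unipotent_inv (r s t : ℝ) : (unipotent r s t)⁻¹ = unipotent r s (-t) := by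
  ext i j
  rw [Matrix.SpecialLinearGroup.SL2_inv_expl]
  fin_cases i <;> fin_cases j <;> simp [coe_unipotent]; ring

theorem unipotent_pow (r s t : ℝ) (n : ℕ) : unipotent r s t ^ n = unipotent r s (n * t) := by
  induction n with
  | zero =>
    ext i j
    fin_cases i <;> fin_cases j <;> simp [coe_unipotent]
  | succ n ih =>
    rw [pow_succ, ih]
    ext i j
    fin_cases i <;> fin_cases j <;>
      simp [coe_unipotent, Matrix.mul_apply, Fin.sum_univ_two] <;> ring

theorem continuous_unipotent {Y : Type*} [TopologicalSpace Y] {r s t : Y → ℝ} (hr : Continuous r)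
    (hs : Continuous s) (ht : Continuous t) : Continuous fun y => unipotent (r y) (s y) (t y) := by
  refine Continuous.subtype_mk (continuous_matrix fun i j => ?_) _
  fin_cases i <;> fin_cases j <;> simp <;> fun_prop

/-- A matrix with nonzero lower left entry is a product upper, lower, upper; any other acquires such
an entry after multiplication by a lower unipotent. -/
theorem eq_top_of_unipotent_mem {K : Subgroup SL(2, ℝ)} (h₁ : ∀ t, unipotent 0 1 t ∈ K)
    (h₂ : ∀ t, unipotent 1 0 t ∈ K) : K = ⊤ := by
  have key : ∀ g : SL(2, ℝ), g 1 0 ≠ 0 → g ∈ K := fun g hg => by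
    have hd := Matrix.det_fin_two (g : Matrix (Fin 2) (Fin 2) ℝ)
    rw [g.det_coe] at hd
    have e : g = unipotent 0 1 ((g 0 0 - 1) / g 1 0) * unipotent 1 0 (-(g 1 0)) *
        unipotent 0 1 ((g 1 1 - 1) / g 1 0) := by
      ext i j
      fin_cases i <;> fin_cases j <;>
        simp [coe_unipotent, Matrix.mul_apply, Fin.sum_univ_two] <;> field_simp <;>
        linarith
    rw [e]
    exact mul_mem (mul_mem (h₁ _) (h₂ _)) (h₁ _)
  refine eq_top_iff.2 fun g _ => ?_
  by_cases hg : g 1 0 = 0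
  · have hd := Matrix.det_fin_two (g : Matrix (Fin 2) (Fin 2) ℝ)
    rw [g.det_coe, hg, mul_zero, sub_zero] at hd
    have h0 : g 0 0 ≠ 0 := fun h0 => by simp [h0] at hd
    have := key (unipotent 1 0 1 * g) (by
      simpa [coe_unipotent, Matrix.mul_apply, Fin.sum_univ_two, hg] using h0)
    exact (Subgroup.mul_mem_cancel_left K (h₂ 1)).1 this
  · exact key g hg

/-- `ε² u(-1/ε) Y u(1/ε)` for the upper unipotent `u`, as a polynomial in `ε`. -/
def scaledConj (Y : Matrix (Fin 2) (Fin 2) ℝ) (ε : ℝ) : Matrix (Fin 2) (Fin 2) ℝ :=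
  !![ε ^ 2 * Y 0 0 - ε * Y 1 0, ε ^ 2 * Y 0 1 + ε * (Y 0 0 - Y 1 1) - Y 1 0;
    ε ^ 2 * Y 1 0, ε ^ 2 * Y 1 1 + ε * Y 1 0]

theorem scaledConj_inv (Y : Matrix (Fin 2) (Fin 2) ℝ) {t : ℝ} (ht : t ≠ 0) :
    scaledConj Y t⁻¹ = (t⁻¹ ^ 2) • ((unipotent 0 1 (-t) : Matrix (Fin 2) (Fin 2) ℝ) * Y *
      (unipotent 0 1 t : Matrix (Fin 2) (Fin 2) ℝ)) := by
  rw [Matrix.eta_fin_two Y, coe_unipotent, coe_unipotent, Matrix.mul_fin_two, Matrix.mul_fin_two]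
  ext i j
  fin_cases i <;> fin_cases j <;> simp [scaledConj] <;> field_simp <;> ring

/-- The lower left entry of `g X g⁻¹`, where `(r, s)` is the second row of `g`. -/
def lowerLeft (X : Matrix (Fin 2) (Fin 2) ℝ) (r s : ℝ) : ℝ :=
  s ^ 2 * X 1 0 + r * s * (X 0 0 - X 1 1) - r ^ 2 * X 0 1

/-- At `ε = 0` only the upper right entry survives, equal to minus the lower left entry of `g X
g⁻¹`; conjugating back by `g` turns it into the nilpotent attached to the second row of `g`. -/
theorem conj_scaledConj_zero (g : SL(2, ℝ)) (X : Matrix (Fin 2) (Fin 2) ℝ) :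
    ((g⁻¹ : SL(2, ℝ)) : Matrix (Fin 2) (Fin 2) ℝ) *
      scaledConj ((g : Matrix (Fin 2) (Fin 2) ℝ) * X *
        ((g⁻¹ : SL(2, ℝ)) : Matrix (Fin 2) (Fin 2) ℝ)) 0 * (g : Matrix (Fin 2) (Fin 2) ℝ) =
      (unipotent (g 1 0) (g 1 1) (-lowerLeft X (g 1 0) (g 1 1)) :
        Matrix (Fin 2) (Fin 2) ℝ) - 1 := by
  have hinv : ((g⁻¹ : SL(2, ℝ)) : Matrix (Fin 2) (Fin 2) ℝ) =
      !![g 1 1, -g 0 1; -g 1 0, g 0 0] := by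
    rw [Matrix.SpecialLinearGroup.SL2_inv_expl]
    rfl
  rw [hinv, Matrix.eta_fin_two (g : Matrix (Fin 2) (Fin 2) ℝ), Matrix.eta_fin_two X]
  ext i j
  fin_cases i <;> fin_cases j <;> simp [scaledConj, coe_unipotent, lowerLeft] <;> ring

/-! ### Non-discrete recurrent subgroups of `SL₂(ℝ)` are dense -/

section Density

variable {K : Subgroup SL(2, ℝ)} {X : Matrix (Fin 2) (Fin 2) ℝ}

theorem tangentCone.unipotent_sub_one_mem (hX : X ∈ tangentCone K)
    (hrec : ∀ O : Set SL(2, ℝ), IsOpen O → O.Nonempty → ∀ N : ℕ, ∃ n ≥ N, ∃ g ∈ O, ∃ g' ∈ O,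
      g⁻¹ * unipotent 0 1 (-n) * g' ∈ K) (g : SL(2, ℝ)) :
    (unipotent (g 1 0) (g 1 1) (-lowerLeft X (g 1 0) (g 1 1)) :
        Matrix (Fin 2) (Fin 2) ℝ) - 1 ∈ tangentCone K := by
  let Φ : SL(2, ℝ) × SL(2, ℝ) × ℝ → Matrix (Fin 2) (Fin 2) ℝ := fun p =>
    ((p.1⁻¹ : SL(2, ℝ)) : Matrix (Fin 2) (Fin 2) ℝ) *
      scaledConj ((p.2.1 : Matrix (Fin 2) (Fin 2) ℝ) * X *
        ((p.2.1⁻¹ : SL(2, ℝ)) : Matrix (Fin 2) (Fin 2) ℝ)) p.2.2 *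
        (p.1 : Matrix (Fin 2) (Fin 2) ℝ)
  have hs : Continuous fun p : Matrix (Fin 2) (Fin 2) ℝ × ℝ => scaledConj p.1 p.2 := by
    have h := fun i j => (continuous_fst (X := Matrix (Fin 2) (Fin 2) ℝ)
      (Y := ℝ)).matrix_elem i j
    refine continuous_matrix fun i j => ?_
    have h00 := h 0 0
    have h01 := h 0 1
    have h10 := h 1 0
    have h11 := h 1 1
    fin_cases i <;> fin_cases j <;> simp [scaledConj] <;> fun_prop
  have hΦ : Continuous Φ := by
    have h1 : Continuous fun p : SL(2, ℝ) × SL(2, ℝ) × ℝ =>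
        ((p.2.1 : Matrix (Fin 2) (Fin 2) ℝ) * X *
          ((p.2.1⁻¹ : SL(2, ℝ)) : Matrix (Fin 2) (Fin 2) ℝ), p.2.2) := by fun_prop
    have h2 := hs.comp h1
    have h3 : Continuous fun p : SL(2, ℝ) × SL(2, ℝ) × ℝ =>
        ((p.1⁻¹ : SL(2, ℝ)) : Matrix (Fin 2) (Fin 2) ℝ) := by fun_prop
    have h4 : Continuous fun p : SL(2, ℝ) × SL(2, ℝ) × ℝ =>
        (p.1 : Matrix (Fin 2) (Fin 2) ℝ) := by fun_prop
    exact (h3.mul h2).mul h4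
  rw [← conj_scaledConj_zero]
  change Φ (g, g, 0) ∈ _
  -- Recurrence gives `a`, `b` near `g` and large `n` for which `Φ (a, b, 1/n)` is `n⁻²` times the
  -- conjugate of `X` by an element of `K`.
  have hcl : (g, g, (0 : ℝ)) ∈ closure (Φ ⁻¹' tangentCone K) := by
    refine mem_closure_iff_nhds.2 fun W hW => ?_
    obtain ⟨U, hU, V, hV, hUV⟩ := mem_nhds_prod_iff.1 hW
    obtain ⟨U', hU', I, hI, hUI⟩ := mem_nhds_prod_iff.1 hV
    obtain ⟨O, hO, hOo, hgO⟩ := mem_nhds_iff.1 (inter_mem hU hU')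
    obtain ⟨N, hN⟩ := eventually_atTop.1
      ((tendsto_inv_atTop_nhds_zero_nat (𝕜 := ℝ)).eventually hI)
    obtain ⟨n, hn, a, ha, b, hb, hab⟩ := hrec O hOo ⟨g, hgO⟩ (N + 1)
    refine ⟨(a, b, (n : ℝ)⁻¹), hUV ⟨(hO ha).1, hUI ⟨(hO hb).2, hN n (by omega)⟩⟩, ?_⟩
    have hn0 : (n : ℝ) ≠ 0 := by
      have : n ≠ 0 := by omega
      exact_mod_cast this
    have h := smul_mem (conj_mem hX hab) (sq_nonneg (n : ℝ)⁻¹)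
    have e : Φ (a, b, (n : ℝ)⁻¹) = ((n : ℝ)⁻¹ ^ 2) •
        (((a⁻¹ * unipotent 0 1 (-n) * b : SL(2, ℝ)) : Matrix (Fin 2) (Fin 2) ℝ) * X *
        (((a⁻¹ * unipotent 0 1 (-n) * b)⁻¹ : SL(2, ℝ)) : Matrix (Fin 2) (Fin 2) ℝ)) := by
      simp only [Φ, scaledConj_inv _ hn0, mul_inv_rev, inv_inv, unipotent_inv, neg_neg,
        Matrix.SpecialLinearGroup.coe_mul, mul_smul_comm, smul_mul_assoc, mul_assoc]
    rw [Set.mem_preimage, e]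
    exact h
  exact ((isClosed K).preimage hΦ).closure_subset hcl

theorem tangentCone.unipotent_mem_closure {r s t : ℝ}
    (h : (unipotent r s t : Matrix (Fin 2) (Fin 2) ℝ) - 1 ∈ tangentCone K) :
    unipotent r s t ∈ K.topologicalClosure := by
  have h1 := one_add_mem_closure h (by
    ext i j
    fin_cases i <;> fin_cases j <;>
      simp [coe_unipotent, Matrix.mul_apply, Fin.sum_univ_two] <;> ring)
  rw [add_sub_cancel] at h1
  exact closure_subtype.2 h1

theorem tangentCone.unipotent_mem_closure_of_lowerLeft_ne_zero (hX : X ∈ tangentCone K)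
    (hrec : ∀ O : Set SL(2, ℝ), IsOpen O → O.Nonempty → ∀ N : ℕ, ∃ n ≥ N, ∃ g ∈ O, ∃ g' ∈ O,
      g⁻¹ * unipotent 0 1 (-n) * g' ∈ K) (g : SL(2, ℝ)) (hg : lowerLeft X (g 1 0) (g 1 1) ≠ 0)
    (t : ℝ) : unipotent (g 1 0) (g 1 1) t ∈ K.topologicalClosure := by
  have h := unipotent_sub_one_mem hX hrec g
  set q := lowerLeft X (g 1 0) (g 1 1)
  have e : ∀ c : ℝ, c • ((unipotent (g 1 0) (g 1 1) (-q) : Matrix (Fin 2) (Fin 2) ℝ) - 1) =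
      (unipotent (g 1 0) (g 1 1) (c * -q) : Matrix (Fin 2) (Fin 2) ℝ) - 1 := fun c => by
    ext i j
    fin_cases i <;> fin_cases j <;> simp [coe_unipotent] <;> ring
  have key : ∀ c : ℝ, 0 ≤ c → unipotent (g 1 0) (g 1 1) (c * -q) ∈ K.topologicalClosure :=
    fun c hc => unipotent_mem_closure (e c ▸ smul_mem h hc)
  have ht : t = (-t / q) * -q := by field_simp
  -- The cone allows only nonnegative scalings; the other half of the one-parameter group comes from
  -- inverses.
  rcases le_total 0 (-t / q) with h0 | h0
  · rw [ht]
    exact key _ h0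
  · have := inv_mem (key (t / q) (by rw [neg_div] at h0; linarith))
    rw [unipotent_inv] at this
    convert this using 2
    field_simp

theorem dense_compl_quadratic_zeros {a b c : ℝ} (h : ¬ (a = 0 ∧ b = 0 ∧ c = 0)) :
    Dense {ε : ℝ | a * ε ^ 2 + b * ε + c ≠ 0} := by
  open Polynomial in
  let p : ℝ[X] := C a * X ^ 2 + C b * X + C c
  have hp : p ≠ 0 := fun h0 => h ⟨by simpa [p, coeff_X, coeff_C] using congrArg (coeff · 2) h0,
    by simpa [p, coeff_X, coeff_C] using congrArg (coeff · 1) h0,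
    by simpa [p, coeff_X, coeff_C] using congrArg (coeff · 0) h0⟩
  have hfin : {ε : ℝ | a * ε ^ 2 + b * ε + c = 0}.Finite :=
    p.roots.toFinset.finite_toSet.subset fun ε hε => by
      simpa [p, hp, Polynomial.IsRoot] using hε
  exact hfin.countable.dense_compl ℝ

theorem dense_of_recurrent_of_not_discrete
    (hrec : ∀ O : Set SL(2, ℝ), IsOpen O → O.Nonempty → ∀ N : ℕ, ∃ n ≥ N, ∃ g ∈ O, ∃ g' ∈ O,
      g⁻¹ * unipotent 0 1 (-n) * g' ∈ K)
    (hK : ∀ U ∈ 𝓝 (1 : SL(2, ℝ)), ∃ h ∈ K, h ∈ U ∧ h ≠ 1) : Dense (K : Set SL(2, ℝ)) := by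
  obtain ⟨X, hX, hX0⟩ := tangentCone.exists_ne_zero hK
  have htr := tangentCone.trace_eq_zero hX
  have hX0' : ¬ (X 0 1 = 0 ∧ X 0 0 - X 1 1 = 0 ∧ X 1 0 = 0) := by
    rintro ⟨h1, h2, h3⟩
    apply hX0
    ext i j
    fin_cases i <;> fin_cases j <;> simp <;> linarith
  have hcl : IsClosed (K.topologicalClosure : Set SL(2, ℝ)) := K.isClosed_topologicalClosure
  have htop : K.topologicalClosure = ⊤ := by
    refine eq_top_of_unipotent_mem (fun t => ?_) (fun t => ?_)
    -- At `ε = 0` itself `lowerLeft` may vanish. As a nonzero quadratic in `ε` it has finitely many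
    -- zeros, so nearby values suffice, and closedness recovers `ε = 0`.
    · have hd : Dense {ε : ℝ | unipotent ε 1 t ∈ K.topologicalClosure} := by
        refine (dense_compl_quadratic_zeros (a := -X 0 1) (b := X 0 0 - X 1 1) (c := X 1 0)
          (by simpa using hX0')).mono fun ε hε => ?_
        refine tangentCone.unipotent_mem_closure_of_lowerLeft_ne_zero hX hrec
          ⟨!![1, 0; ε, 1], by simp⟩ (fun h0 => hε ?_) t
        simp [lowerLeft] at h0
        linarith
      have hc : IsClosed {ε : ℝ | unipotent ε 1 t ∈ K.topologicalClosure} :=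
        hcl.preimage (continuous_unipotent continuous_id continuous_const continuous_const)
      exact hc.closure_subset (hd 0)
    · have hd : Dense {ε : ℝ | unipotent 1 ε t ∈ K.topologicalClosure} := by
        refine (dense_compl_quadratic_zeros (a := X 1 0) (b := X 0 0 - X 1 1) (c := -X 0 1)
          (by simp only [neg_eq_zero]; tauto)).mono fun ε hε => ?_
        refine tangentCone.unipotent_mem_closure_of_lowerLeft_ne_zero hX hrec
          ⟨!![0, -1; 1, ε], by simp⟩ (fun h0 => hε ?_) t
        simp [lowerLeft] at h0
        linarith
      have hc : IsClosed {ε : ℝ | unipotent 1 ε t ∈ K.topologicalClosure} :=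
        hcl.preimage (continuous_unipotent continuous_const continuous_id continuous_const)
      exact hc.closure_subset (hd 0)
  rw [dense_iff_closure_eq, ← Subgroup.topologicalClosure_coe, htop, Subgroup.coe_top]

end Density

/-! ### Overgroups of lattices in `PSL₂(ℝ)` -/

theorem IsLattice.countable {Γ : Subgroup PSL2R} (hΓ : IsLattice Γ) : Countable Γ :=
  haveI := hΓ.discrete
  TopologicalSpace.separableSpace_iff_countable.1 inferInstance

theorem IsLattice.exists_unipotent_mem {Γ : Subgroup PSL2R} (hΓ : IsLattice Γ)
    {O : Set SL(2, ℝ)} (hO : IsOpen O) (hne : O.Nonempty) (N : ℕ) :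
    ∃ n ≥ N, ∃ g ∈ O, ∃ g' ∈ O,
      g⁻¹ * unipotent 0 1 (-n) * g' ∈ Γ.comap (QuotientGroup.mk' (Subgroup.center SL(2, ℝ))) := by
  have := hΓ.countable
  obtain ⟨μ, F, hμ, hF, hfin⟩ := hΓ.finite_covolume
  have := isMulRightInvariant_of_commutator_eq_top PSL2R.commutator_eq_top μ
  let π : SL(2, ℝ) →* PSL2R := QuotientGroup.mk' (Subgroup.center SL(2, ℝ))
  have hπ : IsOpenMap π := QuotientGroup.isOpenMap_coe
  obtain ⟨n, hn, _, ⟨g, hg, rfl⟩, γ, hγ, g', hg', e⟩ :=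
    IsFundamentalDomain.exists_pow_mul_mul_mem hF hfin (hπ O hO) (hne.image π)
      (π (unipotent 0 1 1)) N
  refine ⟨n, hn, g, hg, g', hg', ?_⟩
  rw [← map_pow, unipotent_pow, mul_one] at e
  rw [Subgroup.mem_comap]
  change π _ ∈ Γ
  rw [map_mul, map_mul, e, ← unipotent_inv, map_inv, map_inv]
  simpa [mul_assoc] using hγ

/-- A subgroup of `PSL₂(ℝ)` containing a lattice is dense or discrete. -/
theorem IsLattice.dense_or_discrete {Γ H : Subgroup PSL2R} (hΓ : IsLattice Γ) (hH : Γ ≤ H) :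
    Dense (H : Set PSL2R) ∨ ∃ U ∈ 𝓝 (1 : PSL2R), ∀ x ∈ H, x ∈ U → x = 1 := by
  refine or_iff_not_imp_right.2 fun hnd => ?_
  push Not at hnd
  let π : SL(2, ℝ) →* PSL2R := QuotientGroup.mk' (Subgroup.center SL(2, ℝ))
  have hπ : IsOpenMap π := QuotientGroup.isOpenMap_coe
  have hsurj : Function.Surjective π := QuotientGroup.mk'_surjective _
  have hcont : Continuous π := QuotientGroup.continuous_mk
  have hd : Dense (H.comap π : Set SL(2, ℝ)) := by
    refine dense_of_recurrent_of_not_discrete (fun O hO hne N => ?_) fun U hU => ?_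
    · obtain ⟨n, hn, g, hg, g', hg', h⟩ := hΓ.exists_unipotent_mem hO hne N
      exact ⟨n, hn, g, hg, g', hg', hH h⟩
    · obtain ⟨x, hx, ⟨h, hhU, rfl⟩, hx1⟩ :=
        hnd (π '' U) (by simpa using hπ.image_mem_nhds hU)
      exact ⟨h, hx, hhU, fun h1 => hx1 (by rw [h1, map_one])⟩
  have := hsurj.denseRange.dense_image hcont hd
  rwa [Subgroup.coe_comap, Set.image_preimage_eq _ hsurj] at this

/-- Otherwise the connected unipotent path would be constant modulo the center, yet a nontrivial
upper unipotent does not commute with a lower one. -/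
theorem PSL2R.not_discreteTopology : ¬ DiscreteTopology PSL2R := by
  intro hdisc
  let π : SL(2, ℝ) →* PSL2R := QuotientGroup.mk' (Subgroup.center SL(2, ℝ))
  have hc : Continuous fun t : ℝ => π (unipotent 0 1 t) :=
    (QuotientGroup.continuous_mk : Continuous π).comp
      (continuous_unipotent continuous_const continuous_const continuous_id)
  have h := PreconnectedSpace.constant (inferInstance : PreconnectedSpace ℝ) hc (x := 1) (y := 0)
  have h2 : (unipotent 0 1 1)⁻¹ * unipotent 0 1 0 ∈ Subgroup.center SL(2, ℝ) :=
    QuotientGroup.eq.1 h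
  have h3 := congrArg (fun g : SL(2, ℝ) => g 0 0)
    (Subgroup.mem_center_iff.1 h2 (unipotent 1 0 1))
  rw [unipotent_inv] at h3
  simp [coe_unipotent, Matrix.mul_apply, Fin.sum_univ_two] at h3

/-! ### The commensurator dichotomy -/

theorem ModularEmbedding.dom_le_commG (P : ModularEmbedding) : P.dom ≤ P.commG := by
  intro γ hγ
  -- Conjugating by `γ` in the source and by `ρ γ` in the target changes neither the lattice nor
  -- `ρ`.
  refine ⟨(P.ρ ⟨γ, hγ⟩, γ), ?_, rfl⟩
  refine Commensurable.of_eq ?_ fun x hP hQ => ?_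
  · ext x
    change _ ↔ x ∈ conjSubgroup γ P.dom
    rw [mem_conjSubgroup, Subgroup.mul_mem_cancel_right _ hγ,
      Subgroup.mul_mem_cancel_left _ (inv_mem hγ)]
  · change _ = P.ρ ⟨γ, hγ⟩ * P.ρ _ * (P.ρ ⟨γ, hγ⟩)⁻¹
    rw [← map_mul, ← map_inv, ← map_mul]
    congr 1
    ext1
    simp [mul_assoc]

theorem proposition4 (P : ModularEmbedding) :
    P.dom ≤ P.commG ∧
      (Dense (P.commG : Set PSL2R) ∨ P.dom.IsFiniteRelIndex P.commG) ∧
      ¬ (Dense (P.commG : Set PSL2R) ∧ P.dom.IsFiniteRelIndex P.commG) := by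
  have hle := P.dom_le_commG
  have := P.isLattice.discrete
  refine ⟨hle, ?_, fun h =>
    Subgroup.not_dense_of_isFiniteRelIndex PSL2R.not_discreteTopology hle h.2 h.1⟩
  refine (P.isLattice.dense_or_discrete hle).imp_right ?_
  rintro ⟨U, hU, hUH⟩
  have := P.isLattice.countable
  obtain ⟨μ, F, hμ, hF, hfin⟩ := P.isLattice.finite_covolume
  have := isMulRightInvariant_of_commutator_eq_top PSL2R.commutator_eq_top μ
  exact IsFundamentalDomain.isFiniteRelIndex hF hfin hle hU hUH
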